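/- Let $G=K_3+e$ be the graph with vertices (machines) $m_1,\dots,m_4$ and edges $m_1m_2,\ m_1m_3,\ m_2m_3,\ m_3m_4$. Flow model. An input gives for every machine $m_i$ a bounded measurable set of times $t\ge 0$ at which $m_i$ receives load, at rate $1$. Let $r_i(t)\in\{0,1\}$ be the arrival rate. A feasible schedule sets measurable processing speeds $s_i(t)\ge 0$ such that at almost every time the total speed of every clique of $G$ is at most $1$ and the loads $a_i(t)=\int_0^t (r_i(u)-s_i(u))\,du$ are nonnegative for all $t\ge0$. Its buffer size is $\sup_{t\ge 0,\,i} a_i(t)$, and $\mathrm{Opt}(I)$ is the least buffer size of a feasible schedule for the input $I$. As usual, inputs are scaled to $\mathrm{Opt}(I)=1$, which the online algorithm knows; an algorithm is called $R$-competitive if its (expected, if it is randomized) buffer size is at most $R$ on every input $I$ with $\mathrm{Opt}(I)=1$. A machine can be run only if it has nonzero load or is receiving load. Greedy on a set of pairwise conflicting machines runs, among those that can be run, one with the highest load, among equal loads preferring machines that receive load; machines that are still tied share the time equally. The algorithm PrioGreedy acts as follows at (almost) every time. (A) If one of $m_1,m_2,m_4$ has load at least $4/3$ and receives load, or $\max(a_1,a_2,a_4)>4/3$: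 run $m_4$ (if it can be run) and run Greedy on $m_1,m_2$. (B) Otherwise, if $m_3$ can be run and ($a_3>1/3$ or $a_1=a_2=0$): run $m_3$. (C) Otherwise: run Greedy on $m_1,m_2,m_3$, and run $m_4$ (if it can be run) whenever $m_3$ is not run. If in case (C) $a_3=1/3$ and $m_3$ receives load, so that $a_3$ is at the threshold of (B), the algorithm may switch arbitrarily fast between (B) and (C), that is, its speeds may be any convex combination of the speeds of (B) and (C). Theorem. In the flow model, PrioGreedy is $4/3$-competitive on $K_3+e$: on every input $I$ with $\mathrm{Opt}(I)=1$, every execution of PrioGreedy has buffer size at most $4/3$. This is best possible: if a (deterministic or randomized) online algorithm for $K_3+e$ is $R$-competitive against an oblivious adversary, then $R\ge 4/3$. -/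

import Mathlib

open MeasureTheory
open scoped ENNReal

/-! ### The flow model -/

/-- A (finite) input of the flow model on the machines `V`: for every machine the measurable set of
times at which it receives load (at rate `1`), together with a time after which nothing arrives. -/
structure FlowInput (V : Type) where
  receives : V → Set ℝ
  measurable_receives : ∀ i, MeasurableSet (receives i)
  finite_horizon : ∃ T : ℝ, ∀ i, receives i ⊆ Set.Icc 0 T

/-- The rate (`0` or `1`) at which load arrives on machine `i` at time `t`. -/
noncomputable def FlowInput.rate {V : Type} (I : FlowInput V) (i : V) (t : ℝ) : ℝ :=
  (I.receives i).indicator (fun _ => (1 : ℝ)) t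

/-- The set of machines that are receiving load at time `t`. -/
def FlowInput.receiving {V : Type} (I : FlowInput V) (t : ℝ) : Set V :=
  {i | t ∈ I.receives i}

/-- A feasible schedule for the input `I` on the conflict graph `G`. `speed t i` is the rate at
which load of machine `i` is actually processed at time `t`, so that loads never become negative;
almost everywhere the machines of a clique have total speed at most `1`. -/
structure FlowSchedule {V : Type} (G : SimpleGraph V) (I : FlowInput V) where
  speed : ℝ → V → ℝ
  load : ℝ → V → ℝ
  measurable_speed : ∀ i, Measurable (fun t => speed t i)
  speed_nonneg : ∀ i, ∀ᵐ t : ℝ, 0 ≤ t → 0 ≤ speed t i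
  speed_clique : ∀ K : Finset V, G.IsClique (K : Set V) →
    ∀ᵐ t : ℝ, 0 ≤ t → ∑ i ∈ K, speed t i ≤ 1
  load_eq : ∀ i, ∀ t : ℝ, 0 ≤ t → load t i = ∫ u in (0 : ℝ)..t, (I.rate i u - speed u i)
  load_nonneg : ∀ i, ∀ t : ℝ, 0 ≤ t → 0 ≤ load t i

/-- The buffer size of a schedule: the supremum of all loads over all machines and times. -/
noncomputable def FlowSchedule.buffer {V : Type} {G : SimpleGraph V} {I : FlowInput V}
    (σ : FlowSchedule G I) : ℝ≥0∞ :=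
  ⨆ (t : ℝ) (_ : 0 ≤ t) (i : V), ENNReal.ofReal (σ.load t i)

/-- `B` is the offline optimum of the input `I`: the least buffer size of a feasible schedule. -/
def IsOpt {V : Type} (G : SimpleGraph V) (I : FlowInput V) (B : ℝ≥0∞) : Prop :=
  IsLeast (Set.range (fun σ : FlowSchedule G I => σ.buffer)) B

/-- A deterministic online algorithm: it produces a feasible schedule for every input, and the loads
up to time `t` depend only on the part of the input up to time `t`. -/
structure OnlineAlgorithm {V : Type} (G : SimpleGraph V) where
  run : ∀ I : FlowInput V, FlowSchedule G I
  online : ∀ (I J : FlowInput V) (t : ℝ),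
    (∀ i, I.receives i ∩ Set.Icc 0 t = J.receives i ∩ Set.Icc 0 t) →
    ∀ u ∈ Set.Icc 0 t, ∀ i, (run I).load u i = (run J).load u i

/-- A randomized online algorithm: a random choice of a deterministic online algorithm such that,
for a fixed input, every load at every time is a random variable. -/
structure RandomizedOnlineAlgorithm {V : Type} (G : SimpleGraph V)
    (Ω : Type*) [MeasurableSpace Ω] where
  alg : Ω → OnlineAlgorithm G
  measurable_load : ∀ (I : FlowInput V) (t : ℝ), 0 ≤ t → ∀ i : V,
    Measurable (fun ω => ((alg ω).run I).load t i)

/-- A randomized online algorithm is `R`-competitive against an oblivious adversary: its expected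
buffer size is at most `R` on every input whose offline optimum is `1`. -/
def RandomizedOnlineAlgorithm.IsCompetitive {V : Type} {G : SimpleGraph V}
    {Ω : Type*} [MeasurableSpace Ω] (A : RandomizedOnlineAlgorithm G Ω) (P : Measure Ω)
    (R : ℝ≥0∞) : Prop :=
  ∀ I : FlowInput V, IsOpt G I 1 → ∫⁻ ω, ((A.alg ω).run I).buffer ∂P ≤ R

/-! ### Decisions at one point in time

`a` is the vector of current loads and `S` is the set of machines currently receiving load. -/

/-- A machine can be run if it has nonzero load or is receiving load. -/
def Runnable {V : Type} (a : V → ℝ) (S : Set V) (i : V) : Prop :=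
  0 < a i ∨ i ∈ S

/-- Greedy may select the machine `i` from the clique `M`: it is a runnable machine of highest load,
where among machines of equal load those receiving load are preferred. -/
def GreedySelects {V : Type} (a : V → ℝ) (S : Set V) (M : Finset V) (i : V) : Prop :=
  i ∈ M ∧ Runnable a S i ∧
    ∀ j ∈ M, Runnable a S j → a j < a i ∨ (a j = a i ∧ (j ∈ S → i ∈ S))

open Classical in
/-- The set of machines of the clique `M` which Greedy may select. -/
noncomputable def greedyTop {V : Type} (a : V → ℝ) (S : Set V) (M : Finset V) : Finset V :=
  M.filter (GreedySelects a S M)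

open Classical in
/-- The speeds which Greedy sets on the clique `M`: one machine of `M` is run at a time, and the
selected machines, if tied, share the time equally. -/
noncomputable def greedySpeed {V : Type} (a : V → ℝ) (S : Set V) (M : Finset V) (i : V) : ℝ :=
  if i ∈ greedyTop a S M then 1 / ((greedyTop a S M).card : ℝ) else 0

/-! ### The graph and the algorithm

The machines `m₁, m₂, m₃, m₄` are the elements `0, 1, 2, 3` of `Fin 4`. -/

/-- The graph `K₃ + e`: a triangle on `m₁, m₂, m₃` and the pendant edge between `m₃` and `m₄`. -/
def triangleWithPendant : SimpleGraph (Fin 4) :=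
  SimpleGraph.fromEdgeSet {s(0, 1), s(0, 2), s(1, 2), s(2, 3)}

/-- Condition (A): one of `m₁, m₂, m₄` has load at least `4/3` and receives load, or one of them has
load greater than `4/3`. -/
def CondA (a : Fin 4 → ℝ) (S : Set (Fin 4)) : Prop :=
  (∃ i ∈ ({0, 1, 3} : Finset (Fin 4)), 4 / 3 ≤ a i ∧ i ∈ S) ∨
    ∃ i ∈ ({0, 1, 3} : Finset (Fin 4)), 4 / 3 < a i

/-- Condition (B): `a₃ > 1/3` or `a₁ = a₂ = 0`, where `m₃` can be run. -/
def CondB (a : Fin 4 → ℝ) (S : Set (Fin 4)) : Prop :=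
  (1 / 3 < a 2 ∨ (a 0 = 0 ∧ a 1 = 0)) ∧ Runnable a S 2

open Classical in
/-- Case (A): run `m₄`, and run Greedy on `m₁` and `m₂`. -/
noncomputable def speedsA (a : Fin 4 → ℝ) (S : Set (Fin 4)) : Fin 4 → ℝ :=
  ![greedySpeed a S {0, 1} 0, greedySpeed a S {0, 1} 1, 0, if Runnable a S 3 then 1 else 0]

/-- Case (B): run `m₃`. -/
def speedsB : Fin 4 → ℝ := ![0, 0, 1, 0]

open Classical in
/-- Otherwise: run Greedy on `m₁, m₂, m₃`, and run `m₄` whenever `m₃` is not run. -/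
noncomputable def speedsC (a : Fin 4 → ℝ) (S : Set (Fin 4)) : Fin 4 → ℝ :=
  ![greedySpeed a S {0, 1, 2} 0, greedySpeed a S {0, 1, 2} 1, greedySpeed a S {0, 1, 2} 2,
    if Runnable a S 3 then 1 - greedySpeed a S {0, 1, 2} 2 else 0]

/-- The speeds `s` are a decision of PrioGreedy at loads `a` and receiving machines `S`.
If `a₃` is exactly at the threshold `1/3` of condition (B) while `m₃` receives load, running any
other machine immediately makes condition (B) true; the algorithm then switches rapidly between the
last two cases, so that the speeds are a convex combination of the speeds in these cases. -/
def PrioGreedyDecision (a : Fin 4 → ℝ) (S : Set (Fin 4)) (s : Fin 4 → ℝ) : Prop :=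
  (CondA a S ∧ s = speedsA a S) ∨
  (¬ CondA a S ∧ CondB a S ∧ s = speedsB) ∨
  (¬ CondA a S ∧ ¬ CondB a S ∧ s = speedsC a S) ∨
  (¬ CondA a S ∧ ¬ CondB a S ∧ a 2 = 1 / 3 ∧ (2 : Fin 4) ∈ S ∧
    ∃ c : ℝ, 0 ≤ c ∧ c ≤ 1 ∧ s = c • speedsB + (1 - c) • speedsC a S)

/-- The schedule `σ` is an execution of PrioGreedy on the input `I`: at almost every time the
speeds are the ones PrioGreedy sets for the current loads and the machines receiving load. -/
def FollowsPrioGreedy {I : FlowInput (Fin 4)} (σ : FlowSchedule triangleWithPendant I) : Prop :=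
  ∀ᵐ t : ℝ, 0 ≤ t → PrioGreedyDecision (σ.load t) (I.receiving t) (σ.speed t)

/-- PrioGreedy is `R`-competitive: on every input whose offline optimum is `1`, its buffer size is
at most `R`. -/
def PrioGreedyIsCompetitive (R : ℝ≥0∞) : Prop :=
  ∀ I : FlowInput (Fin 4), IsOpt triangleWithPendant I 1 →
    ∀ σ : FlowSchedule triangleWithPendant I, FollowsPrioGreedy σ → σ.buffer ≤ R

/-! Upper bound. Fix an optimal schedule τ, with all loads at most 1, and let d_i be the load of m_i
under PrioGreedy minus its load under τ. On a clique τ has total speed at most 1, so the total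
excess there cannot grow while PrioGreedy runs the clique at full speed. A bound on the excess
therefore holds as soon as exceeding it forces full speed (`sum_load_sub_le_of_barrier`).

The bounds are d₃ + d₄ ≤ 1/3, d₁ + d₂ + d₃ ≤ 0, d₁ + d₃ ≤ 2/3 and d₂ + d₃ ≤ 2/3. The decision lemmas
`edge`, `triangle`, `triangle_left` and `triangle_right` list when full speed can fail, and the
other bounds exclude these exceptions: a load of at least 4/3 means an excess of at least 1/3. The
argument is circular (edge from pairs, triangle from edge, pairs from triangle), so all four bounds
are proved together, strictly and with slack, up to a first violation time (`excess_lt`). Letting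
the slack vanish gives `excess_le`. Then d₁ + d₂ ≤ 2/3 follows, and these bounds force any machine
with load above 4/3 to be run at full speed.

Lower bound. One unit arrives on each of m₁, m₂, m₃ by time 1, so total load at least 1 remains on
the triangle at time 2. A uniformly random pair then holds at least 2/3 in expectation. If that pair
receives load for two more units of time, its total rises by at least 2, so the larger load is at
least 4/3 in expectation. The optimum knows the pair, empties it by time 2 and needs only buffer 1.
-/

/-! ### A barrier principle for primitives -/

/-- A primitive vanishing at `0` whose integrand is nonpositive wherever the primitive exceeds
`c ≥ 0` never exceeds `c`. -/
theorem primitive_le_of_barrier {f g : ℝ → ℝ} {c T : ℝ}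
    (hg : ∀ t, 0 ≤ t → IntervalIntegrable g volume 0 t)
    (hf : ∀ t, 0 ≤ t → f t = ∫ u in (0 : ℝ)..t, g u) (hc : 0 ≤ c) (hT : 0 ≤ T)
    (h : ∀ᵐ u : ℝ, 0 ≤ u → u < T → c < f u → g u ≤ 0) : f T ≤ c := by
  by_contra! hlt
  have hcont : ContinuousOn f (Set.Icc 0 T) := by
    have := intervalIntegral.continuousOn_primitive_interval' (hg T hT) Set.left_mem_uIcc
    rw [Set.uIcc_of_le hT] at this
    exact this.congr fun t ht => hf t ht.1
  -- The last time in `[0, T]` at which `f ≤ c`; from then on the integrand is nonpositive.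
  let S := Set.Icc 0 T ∩ f ⁻¹' Set.Iic c
  have hS : IsClosed S := hcont.preimage_isClosed_of_isClosed isClosed_Icc isClosed_Iic
  have h0 : (0 : ℝ) ∈ S := by
    refine ⟨⟨le_rfl, hT⟩, ?_⟩
    simpa [hf 0 le_rfl] using hc
  have hbdd : BddAbove S := ⟨T, fun u hu => hu.1.2⟩
  have hs : sSup S ∈ S := hS.csSup_mem ⟨0, h0⟩ hbdd
  set s := sSup S
  have hs0 : 0 ≤ s := hs.1.1
  have hdiff : f T - f s = ∫ u in s..T, g u := by
    rw [hf T hT, hf s hs0, intervalIntegral.integral_interval_sub_left (hg T hT) (hg s hs0)]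
  have hneg : ∫ u in s..T, g u ≤ 0 := by
    -- The hypothesis speaks only of times strictly before `T`, so that it can be fed with
    -- invariants known up to a first violation time.
    rw [intervalIntegral.integral_of_le hs.1.2, integral_Ioc_eq_integral_Ioo]
    refine setIntegral_nonpos_of_ae_restrict ?_
    rw [Filter.EventuallyLE, ae_restrict_iff' measurableSet_Ioo]
    filter_upwards [h] with u hu hmem
    refine hu (hs0.trans hmem.1.le) hmem.2 ?_
    by_contra! hle
    exact absurd (le_csSup hbdd ⟨⟨hs0.trans hmem.1.le, hmem.2.le⟩, hle⟩) (not_le.2 hmem.1)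
  have : f s ≤ c := hs.2
  linarith

/-- A continuous function on `[0, ∞)` stays negative if it cannot become nonnegative for a first
time. -/
theorem forall_neg_of_first_time {F : ℝ → ℝ} (hF : ContinuousOn F (Set.Ici 0))
    (h : ∀ s, 0 ≤ s → (∀ u, 0 ≤ u → u < s → F u < 0) → F s < 0) {t : ℝ} (ht : 0 ≤ t) :
    F t < 0 := by
  by_contra! hlt
  let S := Set.Ici 0 ∩ F ⁻¹' Set.Ici 0
  have hS : IsClosed S := hF.preimage_isClosed_of_isClosed isClosed_Ici isClosed_Ici
  have hbdd : BddBelow S := ⟨0, fun u hu => hu.1⟩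
  have hs : sInf S ∈ S := hS.csInf_mem ⟨t, ht, hlt⟩ hbdd
  refine absurd (h _ hs.1 fun u hu0 hu => ?_) (not_lt.2 hs.2)
  by_contra! hge
  exact absurd (csInf_le hbdd ⟨hu0, hge⟩) (not_le.2 hu)

/-! ### Loads of feasible schedules -/

namespace FlowInput

variable {V : Type} (I : FlowInput V)

theorem measurable_rate (i : V) : Measurable (I.rate i) :=
  measurable_const.indicator (I.measurable_receives i)

theorem rate_nonneg (i : V) (t : ℝ) : 0 ≤ I.rate i t :=
  Set.indicator_nonneg (fun _ _ => zero_le_one) t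

theorem rate_le_one (i : V) (t : ℝ) : I.rate i t ≤ 1 :=
  Set.indicator_le_self' (fun _ _ => zero_le_one) t

theorem intervalIntegrable_rate (i : V) (s t : ℝ) :
    IntervalIntegrable (I.rate i) volume s t := by
  refine (intervalIntegrable_const (c := (1 : ℝ))).mono_fun
    (I.measurable_rate i).aestronglyMeasurable (Filter.Eventually.of_forall fun u => ?_)
  simpa [abs_of_nonneg (I.rate_nonneg i u)] using I.rate_le_one i u

end FlowInput

namespace FlowSchedule

variable {V : Type} {G : SimpleGraph V} {I : FlowInput V} (σ : FlowSchedule G I)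

theorem speed_le_one (i : V) : ∀ᵐ t : ℝ, 0 ≤ t → σ.speed t i ≤ 1 := by
  have := σ.speed_clique {i} (by simp)
  simpa using this

theorem intervalIntegrable_speed (i : V) {s t : ℝ} (hs : 0 ≤ s) (ht : 0 ≤ t) :
    IntervalIntegrable (fun u => σ.speed u i) volume s t := by
  refine (intervalIntegrable_const (c := (1 : ℝ))).mono_fun
    (σ.measurable_speed i).aestronglyMeasurable ?_
  rw [Filter.EventuallyLE, ae_restrict_iff' measurableSet_uIoc]
  filter_upwards [σ.speed_nonneg i, σ.speed_le_one i] with u h0 h1 hu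
  have hu0 : 0 ≤ u := (le_min hs ht).trans hu.1.le
  simpa [abs_of_nonneg (h0 hu0)] using h1 hu0

theorem intervalIntegrable_net (i : V) {s t : ℝ} (hs : 0 ≤ s) (ht : 0 ≤ t) :
    IntervalIntegrable (fun u => I.rate i u - σ.speed u i) volume s t :=
  (I.intervalIntegrable_rate i s t).sub (σ.intervalIntegrable_speed i hs ht)

theorem load_sub_load (i : V) {s t : ℝ} (hs : 0 ≤ s) (ht : 0 ≤ t) :
    σ.load t i - σ.load s i = ∫ u in s..t, (I.rate i u - σ.speed u i) := by
  rw [σ.load_eq i t ht, σ.load_eq i s hs]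
  exact intervalIntegral.integral_interval_sub_left (σ.intervalIntegrable_net i le_rfl ht)
    (σ.intervalIntegrable_net i le_rfl hs)

theorem load_zero (i : V) : σ.load 0 i = 0 := by
  simp [σ.load_eq i 0 le_rfl]

theorem continuousOn_load (i : V) : ContinuousOn (fun t => σ.load t i) (Set.Ici 0) := by
  have : ∀ T : ℝ, 0 ≤ T → ContinuousOn (fun t => σ.load t i) (Set.Icc 0 T) := fun T hT => by
    have := intervalIntegral.continuousOn_primitive_interval'
      (σ.intervalIntegrable_net i le_rfl hT) Set.left_mem_uIcc
    rw [Set.uIcc_of_le hT] at this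
    exact this.congr fun t ht => σ.load_eq i t ht.1
  intro t ht
  have ht0 : (0 : ℝ) ≤ t := ht
  refine (this (t + 1) (by linarith) t ⟨ht, by linarith⟩).mono_of_mem_nhdsWithin ?_
  have hmem : Set.Iio (t + 1) ∈ nhdsWithin t (Set.Ici 0) :=
    mem_nhdsWithin_of_mem_nhds (Iio_mem_nhds (by linarith))
  filter_upwards [hmem, self_mem_nhdsWithin] with u hu hu0
  exact ⟨hu0, le_of_lt hu⟩

theorem load_sub_eq_integral (τ : FlowSchedule G I) (i : V) {t : ℝ} (ht : 0 ≤ t) :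
    σ.load t i - τ.load t i = ∫ u in (0 : ℝ)..t, (τ.speed u i - σ.speed u i) := by
  rw [σ.load_eq i t ht, τ.load_eq i t ht, ← intervalIntegral.integral_sub
    (σ.intervalIntegrable_net i le_rfl ht) (τ.intervalIntegrable_net i le_rfl ht)]
  simp

theorem intervalIntegrable_speed_sub (τ : FlowSchedule G I) (i : V) {t : ℝ} (ht : 0 ≤ t) :
    IntervalIntegrable (fun u => τ.speed u i - σ.speed u i) volume 0 t :=
  (τ.intervalIntegrable_speed i le_rfl ht).sub (σ.intervalIntegrable_speed i le_rfl ht)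

/-- The total load of a clique decreases at most at rate `1`, apart from arrivals. -/
theorem sum_arrivals_sub_le (K : Finset V) (hK : G.IsClique (K : Set V)) {s t : ℝ} (hs : 0 ≤ s)
    (hst : s ≤ t) :
    (∑ i ∈ K, ∫ u in s..t, I.rate i u) - (t - s) ≤ ∑ i ∈ K, (σ.load t i - σ.load s i) := by
  have ht := hs.trans hst
  have hint : ∑ i ∈ K, ∫ u in s..t, σ.speed u i ≤ t - s := by
    rw [← intervalIntegral.integral_finsetSum
      (fun i _ => σ.intervalIntegrable_speed i hs ht)]
    calc ∫ u in s..t, ∑ i ∈ K, σ.speed u i ≤ ∫ _ in s..t, (1 : ℝ) := by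
          refine intervalIntegral.integral_mono_ae_restrict hst ?_ intervalIntegrable_const ?_
          · simpa only [← Finset.sum_fn] using IntervalIntegrable.sum K
              (fun i _ => σ.intervalIntegrable_speed i hs ht)
          · rw [Filter.EventuallyLE, ae_restrict_iff' measurableSet_Icc]
            filter_upwards [σ.speed_clique K hK] with u hu hmem
            exact hu (hs.trans hmem.1)
      _ = t - s := by simp
  have : ∀ i ∈ K, σ.load t i - σ.load s i
      = (∫ u in s..t, I.rate i u) - ∫ u in s..t, σ.speed u i := fun i _ => by
    rw [σ.load_sub_load i hs ht, intervalIntegral.integral_sub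
      (I.intervalIntegrable_rate i s t) (σ.intervalIntegrable_speed i hs ht)]
  rw [Finset.sum_congr rfl this, Finset.sum_sub_distrib]
  linarith

theorem ofReal_load_le_buffer {t : ℝ} (ht : 0 ≤ t) (i : V) :
    ENNReal.ofReal (σ.load t i) ≤ σ.buffer :=
  le_iSup_of_le t (le_iSup_of_le ht (le_iSup_of_le i le_rfl))

theorem buffer_le {B : ℝ≥0∞} (h : ∀ t, 0 ≤ t → ∀ i, ENNReal.ofReal (σ.load t i) ≤ B) :
    σ.buffer ≤ B :=
  iSup_le fun t => iSup_le fun ht => iSup_le fun i => h t ht i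

end FlowSchedule

/-! ### Greedy -/

section Greedy

variable {V : Type} {a : V → ℝ} {S : Set V} {M : Finset V}

theorem load_le_of_not_runnable {i : V} (h : ¬ Runnable a S i) : a i ≤ 0 :=
  not_lt.1 fun h' => h (Or.inl h')

theorem greedyTop_nonempty {j : V} (hj : j ∈ M) (hrun : Runnable a S j) :
    (greedyTop a S M).Nonempty := by
  classical
  -- Greedy's preference is the lexicographic order on load and receiving status.
  let f : V → Lex (ℝ × ℕ) := fun i => toLex (a i, if i ∈ S then 1 else 0)
  obtain ⟨i, hi, hmax⟩ := (M.filter (Runnable a S)).exists_max_image f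
    ⟨j, Finset.mem_filter.2 ⟨hj, hrun⟩⟩
  rw [Finset.mem_filter] at hi
  refine ⟨i, Finset.mem_filter.2 ⟨hi.1, hi.1, hi.2, fun k hk hkrun => ?_⟩⟩
  have := hmax k (Finset.mem_filter.2 ⟨hk, hkrun⟩)
  rw [Prod.Lex.le_iff] at this
  rcases this with h | ⟨h, h'⟩
  · exact Or.inl h
  · refine Or.inr ⟨h, fun hkS => ?_⟩
    by_contra hiS
    simp [f, hkS, hiS] at h'

theorem sum_greedySpeed {j : V} (hj : j ∈ M) (hrun : Runnable a S j) :
    ∑ i ∈ M, greedySpeed a S M i = 1 := by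
  classical
  have hne := greedyTop_nonempty hj hrun
  have hsub : greedyTop a S M ⊆ M := Finset.filter_subset _ _
  have hc : ((greedyTop a S M).card : ℝ) ≠ 0 := by
    exact_mod_cast hne.card_pos.ne'
  unfold greedySpeed
  rw [Finset.sum_ite_mem, Finset.inter_eq_right.2 hsub, Finset.sum_const, nsmul_eq_mul]
  field_simp

theorem le_of_greedySpeed_ne_zero (ha : ∀ i, 0 ≤ a i) {i : V} (h : greedySpeed a S M i ≠ 0) {j : V}
    (hj : j ∈ M) : a j ≤ a i := by
  classical
  have hi : i ∈ greedyTop a S M := by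
    by_contra hi
    simp [greedySpeed, hi] at h
  have hsel : GreedySelects a S M i := (Finset.mem_filter.1 hi).2
  by_cases hrun : Runnable a S j
  · rcases hsel.2.2 j hj hrun with h' | h'
    exacts [h'.le, h'.1.le]
  · exact (load_le_of_not_runnable hrun).trans (ha i)

end Greedy

/-! ### PrioGreedy at one point in time -/

section Decision

variable {a : Fin 4 → ℝ} {S : Set (Fin 4)} {s : Fin 4 → ℝ}

theorem greedy_pair_cases (ha : ∀ i, 0 ≤ a i) :
    (a 0 = 0 ∧ a 1 = 0) ∨
      greedySpeed a S {0, 1} 0 + greedySpeed a S {0, 1} 1 = 1 := by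
  by_cases h0 : Runnable a S 0
  · right
    simpa using sum_greedySpeed (M := {0, 1}) (by simp) h0
  by_cases h1 : Runnable a S 1
  · right
    simpa using sum_greedySpeed (M := {0, 1}) (by simp) h1
  exact Or.inl ⟨(load_le_of_not_runnable h0).antisymm (ha 0),
    (load_le_of_not_runnable h1).antisymm (ha 1)⟩

theorem greedy_triangle_cases (ha : ∀ i, 0 ≤ a i) :
    (a 0 = 0 ∧ a 1 = 0 ∧ a 2 = 0) ∨
      greedySpeed a S {0, 1, 2} 0 + greedySpeed a S {0, 1, 2} 1
        + greedySpeed a S {0, 1, 2} 2 = 1 := by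
  by_cases h : ∃ i ∈ ({0, 1, 2} : Finset (Fin 4)), Runnable a S i
  · right
    obtain ⟨i, hi, hrun⟩ := h
    simpa [add_assoc] using sum_greedySpeed hi hrun
  · push Not at h
    refine Or.inl ⟨?_, ?_, ?_⟩ <;>
      exact (load_le_of_not_runnable (h _ (by simp))).antisymm (ha _)

/-- Forgets who receives load: to exclude case (A) in the exceptions below, a load of at least 4/3
suffices. -/
theorem CondA.cases (h : CondA a S) : 4 / 3 ≤ a 0 ∨ 4 / 3 ≤ a 1 ∨ 4 / 3 ≤ a 3 := by
  rcases h with ⟨i, hi, h, -⟩ | ⟨i, hi, h⟩ <;> simp at hi <;> rcases hi with rfl | rfl | rfl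
  all_goals first
    | exact Or.inl (by linarith)
    | exact Or.inr (Or.inl (by linarith))
    | exact Or.inr (Or.inr (by linarith))

theorem load_le_third_of_not_condB (h : ¬ CondB a S) : a 2 ≤ 1 / 3 := by
  by_contra! h'
  exact h ⟨Or.inl h', Or.inl (by linarith)⟩

/-- The decisions of PrioGreedy in cases other than (A) and (B), uniformly: a convex combination of
(B) and (C), where (B) has weight zero unless `m₃` receives load and is at the threshold. -/
theorem PrioGreedyDecision.cases (h : PrioGreedyDecision a S s) :
    (CondA a S ∧ s = speedsA a S) ∨ (¬ CondA a S ∧ CondB a S ∧ s = speedsB) ∨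
      (¬ CondA a S ∧ ¬ CondB a S ∧ ∃ c : ℝ, 0 ≤ c ∧ c ≤ 1 ∧
        (c = 0 ∨ (a 2 = 1 / 3 ∧ (2 : Fin 4) ∈ S)) ∧ s = c • speedsB + (1 - c) • speedsC a S) := by
  rcases h with h | h | ⟨hA, hB, h⟩ | ⟨hA, hB, h2, hS, c, h0, h1, h⟩
  · exact Or.inl h
  · exact Or.inr (Or.inl h)
  · exact Or.inr (Or.inr ⟨hA, hB, 0, le_rfl, zero_le_one, Or.inl rfl, by simpa using h⟩)
  · exact Or.inr (Or.inr ⟨hA, hB, c, h0, h1, Or.inr ⟨h2, hS⟩, h⟩)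

/-- `m₃` and `m₄` are run at full total speed, unless `m₄` is empty. -/
theorem PrioGreedyDecision.edge (h : PrioGreedyDecision a S s) (ha : ∀ i, 0 ≤ a i) :
    1 ≤ s 2 + s 3 ∨ (a 3 = 0 ∧ (a 2 ≤ 1 / 3 ∨ 4 / 3 ≤ a 0 ∨ 4 / 3 ≤ a 1)) := by
  by_cases h3 : Runnable a S 3
  · left
    rcases h.cases with ⟨-, rfl⟩ | ⟨-, -, rfl⟩ | ⟨-, -, c, -, -, -, rfl⟩
    · simp [speedsA, h3]
    · simp [speedsB]
    · simp only [speedsB, speedsC, h3, if_true, Pi.add_apply, Pi.smul_apply, smul_eq_mul,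
        Matrix.cons_val]
      linarith
  · have h0 : a 3 = 0 := (load_le_of_not_runnable h3).antisymm (ha 3)
    rcases h.cases with ⟨hA, rfl⟩ | ⟨-, -, rfl⟩ | ⟨-, hB, -⟩
    · right
      refine ⟨h0, ?_⟩
      rcases hA.cases with h | h | h
      · exact Or.inr (Or.inl h)
      · exact Or.inr (Or.inr h)
      · linarith
    · left
      simp [speedsB]
    · exact Or.inr ⟨h0, Or.inl (load_le_third_of_not_condB hB)⟩

/-- The triangle is run at full total speed, unless it is empty or `m₄` is highly loaded. -/
theorem PrioGreedyDecision.triangle (h : PrioGreedyDecision a S s) (ha : ∀ i, 0 ≤ a i) :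
    1 ≤ s 0 + s 1 + s 2 ∨ (a 0 = 0 ∧ a 1 = 0 ∧ (a 2 = 0 ∨ 4 / 3 ≤ a 3)) := by
  rcases h.cases with ⟨hA, rfl⟩ | ⟨-, -, rfl⟩ | ⟨-, hB, c, h0, h1, hc, rfl⟩
  · rcases greedy_pair_cases (S := S) ha with ⟨ha0, ha1⟩ | hsum
    · right
      refine ⟨ha0, ha1, Or.inr ?_⟩
      rcases hA.cases with h | h | h <;> linarith
    · left
      simp [speedsA, hsum]
  · left
    simp [speedsB]
  · rcases greedy_triangle_cases (S := S) ha with ⟨ha0, ha1, ha2⟩ | hsum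
    · exact Or.inr ⟨ha0, ha1, Or.inl ha2⟩
    · left
      simp only [speedsB, speedsC, Pi.add_apply, Pi.smul_apply, smul_eq_mul, Matrix.cons_val]
      linear_combination (c - 1) * hsum

/-- `m₁` and `m₃` are run at full total speed, unless `m₂` has at least the load of `m₁`. -/
theorem PrioGreedyDecision.triangle_left (h : PrioGreedyDecision a S s) (ha : ∀ i, 0 ≤ a i) :
    1 ≤ s 0 + s 2 ∨ (a 0 ≤ a 1 ∧ (a 2 ≤ 1 / 3 ∨ 4 / 3 ≤ a 1 ∨ 4 / 3 ≤ a 3)) := by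
  by_cases hle : a 0 ≤ a 1
  · rcases h.cases with ⟨hA, rfl⟩ | ⟨-, -, rfl⟩ | ⟨-, hB, -⟩
    · right
      refine ⟨hle, Or.inr ?_⟩
      rcases hA.cases with h | h | h
      exacts [Or.inl (h.trans hle), Or.inl h, Or.inr h]
    · left
      simp [speedsB]
    · exact Or.inr ⟨hle, Or.inl (load_le_third_of_not_condB hB)⟩
  left
  have hpos : 0 < a 0 := (ha 1).trans_lt (not_le.1 hle)
  -- Greedy never runs the strictly less loaded m₂, so the full speed of its clique goes to the
  -- remaining machines.
  have hM : ∀ M : Finset (Fin 4), (0 : Fin 4) ∈ M → greedySpeed a S M 1 = 0 := fun M h0 => by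
    by_contra hne
    exact hle (le_of_greedySpeed_ne_zero ha hne h0)
  rcases h.cases with ⟨hA, rfl⟩ | ⟨-, -, rfl⟩ | ⟨-, hB, c, h0, h1, hc, rfl⟩
  · rcases greedy_pair_cases (S := S) ha with ⟨ha0, -⟩ | hsum
    · linarith
    · rw [hM _ (by simp), add_zero] at hsum
      simp [speedsA, hsum]
  · simp [speedsB]
  · rcases greedy_triangle_cases (S := S) ha with ⟨ha0, -⟩ | hsum
    · linarith
    · rw [hM _ (by simp)] at hsum
      simp only [speedsB, speedsC, Pi.add_apply, Pi.smul_apply, smul_eq_mul, Matrix.cons_val]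
      linear_combination (c - 1) * hsum

/-- `m₂` and `m₃` are run at full total speed, unless `m₁` has at least the load of `m₂`. -/
theorem PrioGreedyDecision.triangle_right (h : PrioGreedyDecision a S s) (ha : ∀ i, 0 ≤ a i) :
    1 ≤ s 1 + s 2 ∨ (a 1 ≤ a 0 ∧ (a 2 ≤ 1 / 3 ∨ 4 / 3 ≤ a 0 ∨ 4 / 3 ≤ a 3)) := by
  by_cases hle : a 1 ≤ a 0
  · rcases h.cases with ⟨hA, rfl⟩ | ⟨-, -, rfl⟩ | ⟨-, hB, -⟩
    · right
      refine ⟨hle, Or.inr ?_⟩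
      rcases hA.cases with h | h | h
      exacts [Or.inl h, Or.inl (h.trans hle), Or.inr h]
    · left
      simp [speedsB]
    · exact Or.inr ⟨hle, Or.inl (load_le_third_of_not_condB hB)⟩
  left
  have hpos : 0 < a 1 := (ha 0).trans_lt (not_le.1 hle)
  have hM : ∀ M : Finset (Fin 4), (1 : Fin 4) ∈ M → greedySpeed a S M 0 = 0 := fun M h0 => by
    by_contra hne
    exact hle (le_of_greedySpeed_ne_zero ha hne h0)
  rcases h.cases with ⟨hA, rfl⟩ | ⟨-, -, rfl⟩ | ⟨-, hB, c, h0, h1, hc, rfl⟩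
  · rcases greedy_pair_cases (S := S) ha with ⟨-, ha1⟩ | hsum
    · linarith
    · rw [hM _ (by simp), zero_add] at hsum
      simp [speedsA, hsum]
  · simp [speedsB]
  · rcases greedy_triangle_cases (S := S) ha with ⟨-, ha1, -⟩ | hsum
    · linarith
    · rw [hM _ (by simp)] at hsum
      simp only [speedsB, speedsC, Pi.add_apply, Pi.smul_apply, smul_eq_mul, Matrix.cons_val]
      linear_combination (c - 1) * hsum

/-- `m₁` and `m₂` are run at full total speed, unless `m₃` has reached the threshold or both have
small total load. -/
theorem PrioGreedyDecision.pair (h : PrioGreedyDecision a S s) (ha : ∀ i, 0 ≤ a i) :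
    1 ≤ s 0 + s 1 ∨ 1 / 3 ≤ a 2 ∨ a 0 + a 1 ≤ 2 / 3 := by
  rcases le_or_gt (1 / 3) (a 2) with h2 | h2
  · exact Or.inr (Or.inl h2)
  rcases h.cases with ⟨hA, rfl⟩ | ⟨-, ⟨h' | h', -⟩, rfl⟩ | ⟨-, hB, c, h0, h1, hc, rfl⟩
  · rcases greedy_pair_cases (S := S) ha with ⟨ha0, ha1⟩ | hsum
    · exact Or.inr (Or.inr (by linarith))
    · left
      simp [speedsA, hsum]
  · exact Or.inr (Or.inl h'.le)
  · exact Or.inr (Or.inr (by linarith))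
  · rcases hc with rfl | ⟨hc, -⟩
    · by_cases h2s : greedySpeed a S {0, 1, 2} 2 = 0
      · rcases greedy_triangle_cases (S := S) ha with ⟨ha0, ha1, -⟩ | hsum
        · exact Or.inr (Or.inr (by linarith))
        · rw [h2s, add_zero] at hsum
          left
          simp [speedsC, hsum]
      -- If Greedy runs m₃, then m₁ and m₂ have at most its load, which is below 1/3.
      · have h0' := le_of_greedySpeed_ne_zero ha h2s (j := 0) (by simp)
        have h1' := le_of_greedySpeed_ne_zero ha h2s (j := 1) (by simp)
        exact Or.inr (Or.inr (by linarith))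
    · linarith

/-- Above the threshold, `m₃` is run unless another machine is highly loaded. -/
theorem PrioGreedyDecision.above_threshold (h : PrioGreedyDecision a S s) (h2 : 1 / 3 < a 2) :
    1 ≤ s 2 ∨ 4 / 3 ≤ a 0 ∨ 4 / 3 ≤ a 1 ∨ 4 / 3 ≤ a 3 := by
  rcases h.cases with ⟨hA, -⟩ | ⟨-, -, rfl⟩ | ⟨-, hB, -⟩
  · exact Or.inr hA.cases
  · left
    simp [speedsB]
  · exact absurd (load_le_third_of_not_condB hB) (not_le.2 h2)

theorem PrioGreedyDecision.eq_speedsA (h : PrioGreedyDecision a S s) {i : Fin 4}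
    (hi : i ∈ ({0, 1, 3} : Finset (Fin 4))) (hai : 4 / 3 < a i) : s = speedsA a S := by
  have hA : CondA a S := Or.inr ⟨i, hi, hai⟩
  rcases h with h | h | h | h
  · exact h.2
  all_goals exact absurd hA h.1

/-- Case (A) applies and gives m₃ speed zero, so the full speed of m₁ and m₃ falls to m₁ alone. -/
theorem PrioGreedyDecision.run_first (h : PrioGreedyDecision a S s) (ha : ∀ i, 0 ≤ a i)
    (h0 : 4 / 3 < a 0) (hlt : a 1 < a 0) : 1 ≤ s 0 := by
  have := h.triangle_left ha
  rw [h.eq_speedsA (i := 0) (by simp) h0] at this ⊢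
  rcases this with h | h
  · simpa [speedsA] using h
  · exact absurd h.1 (not_le.2 hlt)

theorem PrioGreedyDecision.run_second (h : PrioGreedyDecision a S s) (ha : ∀ i, 0 ≤ a i)
    (h1 : 4 / 3 < a 1) (hlt : a 0 < a 1) : 1 ≤ s 1 := by
  have := h.triangle_right ha
  rw [h.eq_speedsA (i := 1) (by simp) h1] at this ⊢
  rcases this with h | h
  · simpa [speedsA] using h
  · exact absurd h.1 (not_le.2 hlt)

theorem PrioGreedyDecision.run_fourth (h : PrioGreedyDecision a S s) (h3 : 4 / 3 < a 3) :
    1 ≤ s 3 := by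
  have hrun : Runnable a S 3 := Or.inl (by linarith)
  rw [h.eq_speedsA (i := 3) (by simp) h3]
  simp [speedsA, hrun]

end Decision

/-! ### Barriers for loads -/

namespace FlowSchedule

variable {V : Type} {G : SimpleGraph V} {I : FlowInput V} (σ τ : FlowSchedule G I)

/-- On a clique, the excess of the total load of `σ` over that of `τ` stays at most `c ≥ 0` if `σ`
runs the clique at full speed whenever the excess is larger. -/
theorem sum_load_sub_le_of_barrier (K : Finset V) (hK : G.IsClique (K : Set V)) {c T : ℝ}
    (hc : 0 ≤ c) (hT : 0 ≤ T)
    (h : ∀ᵐ u : ℝ, 0 ≤ u → u < T → c < ∑ i ∈ K, (σ.load u i - τ.load u i) →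
      1 ≤ ∑ i ∈ K, σ.speed u i) :
    ∑ i ∈ K, (σ.load T i - τ.load T i) ≤ c := by
  refine primitive_le_of_barrier (f := fun t => ∑ i ∈ K, (σ.load t i - τ.load t i))
    (g := fun u => ∑ i ∈ K, (τ.speed u i - σ.speed u i)) (fun t ht => ?_) (fun t ht => ?_) hc hT ?_
  · simpa only [← Finset.sum_fn] using IntervalIntegrable.sum K
      (fun i _ => σ.intervalIntegrable_speed_sub τ i ht)
  · rw [intervalIntegral.integral_finsetSum
      (fun i _ => σ.intervalIntegrable_speed_sub τ i ht)]
    exact Finset.sum_congr rfl fun i _ => σ.load_sub_eq_integral τ i ht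
  · filter_upwards [h, τ.speed_clique K hK] with u hu hτ hu0 huT hlt
    rw [Finset.sum_sub_distrib]
    linarith [hu hu0 huT hlt, hτ hu0]

/-- The load of a machine stays at most `c ≥ 0` if the machine is run at full speed whenever its
load is larger. -/
theorem load_le_of_barrier (i : V) {c T : ℝ} (hc : 0 ≤ c) (hT : 0 ≤ T)
    (h : ∀ᵐ u : ℝ, 0 ≤ u → c < σ.load u i → 1 ≤ σ.speed u i) : σ.load T i ≤ c := by
  refine primitive_le_of_barrier (fun t ht => σ.intervalIntegrable_net i le_rfl ht)
    (fun t ht => σ.load_eq i t ht) hc hT ?_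
  filter_upwards [h] with u hu hu0 _ hlt
  linarith [hu hu0 hlt, I.rate_le_one i u]

theorem load_le_of_buffer_le {B : ℝ} (hB : 0 ≤ B) (h : σ.buffer ≤ ENNReal.ofReal B) {t : ℝ}
    (ht : 0 ≤ t) (i : V) : σ.load t i ≤ B :=
  (ENNReal.ofReal_le_ofReal_iff hB).1 ((σ.ofReal_load_le_buffer ht i).trans h)

end FlowSchedule

/-! ### The upper bound -/

theorem isClique_triangle :
    triangleWithPendant.IsClique ((({0, 1, 2} : Finset (Fin 4)) : Set (Fin 4))) := by
  simp [SimpleGraph.isClique_iff, Set.Pairwise, triangleWithPendant]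

theorem isClique_pendant :
    triangleWithPendant.IsClique ((({2, 3} : Finset (Fin 4)) : Set (Fin 4))) := by
  simp [SimpleGraph.isClique_iff, Set.Pairwise, triangleWithPendant]

theorem isClique_of_subset_triangle {K : Finset (Fin 4)} (hK : K ⊆ {0, 1, 2}) :
    triangleWithPendant.IsClique (K : Set (Fin 4)) :=
  isClique_triangle.subset (by exact_mod_cast hK)

section UpperBound

variable {I : FlowInput (Fin 4)} {σ τ : FlowSchedule triangleWithPendant I}

theorem FollowsPrioGreedy.decision (hσ : FollowsPrioGreedy σ) :
    ∀ᵐ t : ℝ, 0 ≤ t → PrioGreedyDecision (σ.load t) (I.receiving t) (σ.speed t) ∧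
      ∀ i, 0 ≤ σ.load t i := by
  filter_upwards [hσ] with t ht h0
  exact ⟨ht h0, fun i => σ.load_nonneg i t h0⟩

/-- The invariants of PrioGreedy relative to a schedule `τ` of buffer size `1`, up to a small
slack; the weights of the slack break the circular dependence of the invariants. -/
theorem FollowsPrioGreedy.excess_lt (hσ : FollowsPrioGreedy σ)
    (hτ : ∀ t, 0 ≤ t → ∀ i, τ.load t i ≤ 1) {ε : ℝ} (hε : 0 < ε) (hε' : ε < 1 / 100) {t : ℝ}
    (ht : 0 ≤ t) :
    (σ.load t 2 - τ.load t 2) + (σ.load t 3 - τ.load t 3) < 1 / 3 + 4 * ε ∧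
    (σ.load t 0 - τ.load t 0) + (σ.load t 1 - τ.load t 1) + (σ.load t 2 - τ.load t 2) < 5 * ε ∧
    (σ.load t 0 - τ.load t 0) + (σ.load t 2 - τ.load t 2) < 2 / 3 + 3 * ε ∧
    (σ.load t 1 - τ.load t 1) + (σ.load t 2 - τ.load t 2) < 2 / 3 + 3 * ε := by
  set d : Fin 4 → ℝ → ℝ := fun i t => σ.load t i - τ.load t i with hd
  have hdc : ∀ i, ContinuousOn (d i) (Set.Ici 0) := fun i =>
    (σ.continuousOn_load i).sub (τ.continuousOn_load i)
  have hd0 : ∀ i, d i 0 = 0 := fun i => by simp [hd, FlowSchedule.load_zero]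
  -- The four strict bounds packed into one continuous function that must stay negative.
  let F : ℝ → ℝ := fun t => max (max (d 2 t + d 3 t - (1 / 3 + 4 * ε))
    (d 0 t + d 1 t + d 2 t - 5 * ε))
    (max (d 0 t + d 2 t - (2 / 3 + 3 * ε)) (d 1 t + d 2 t - (2 / 3 + 3 * ε)))
  have hF : ContinuousOn F (Set.Ici 0) :=
    ContinuousOn.sup
      (ContinuousOn.sup (((hdc 2).add (hdc 3)).sub continuousOn_const)
        ((((hdc 0).add (hdc 1)).add (hdc 2)).sub continuousOn_const))
      (ContinuousOn.sup (((hdc 0).add (hdc 2)).sub continuousOn_const)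
        (((hdc 1).add (hdc 2)).sub continuousOn_const))
  have hFlt : ∀ t, F t < 0 ↔ (d 2 t + d 3 t < 1 / 3 + 4 * ε ∧ d 0 t + d 1 t + d 2 t < 5 * ε ∧
      d 0 t + d 2 t < 2 / 3 + 3 * ε ∧ d 1 t + d 2 t < 2 / 3 + 3 * ε) := fun t => by
    simp only [F, max_lt_iff, sub_neg, and_assoc]
  refine (hFlt t).1 (forall_neg_of_first_time hF (fun s hs hlt => (hFlt s).2 ?_) ht)
  simp only [hFlt] at hlt
  have bounds : ∀ᵐ u : ℝ, 0 ≤ u → ∀ i, 0 ≤ σ.load u i ∧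
      σ.load u i - 1 ≤ d i u ∧ d i u ≤ σ.load u i := by
    refine Filter.Eventually.of_forall fun u hu i => ⟨σ.load_nonneg i u hu, ?_, ?_⟩
    · linarith [hτ u hu i]
    · linarith [τ.load_nonneg i u hu]
  refine ⟨?_, ?_, ?_, ?_⟩
  · have := σ.sum_load_sub_le_of_barrier τ {2, 3} isClique_pendant (c := 1 / 3 + 3.5 * ε)
      (by positivity) hs (by
      filter_upwards [hσ.decision, bounds] with u hu hb hu0 hus hlarge
      obtain ⟨hdec, ha⟩ := hu hu0
      obtain ⟨-, h2, h3, h4⟩ := hlt u hu0 hus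
      have hb := hb hu0
      have hb0 := hb 0
      have hb1 := hb 1
      have hb2 := hb 2
      have hb3 := hb 3
      simp only [Finset.sum_pair (show (2 : Fin 4) ≠ 3 by decide)] at hlarge ⊢
      change _ < d 2 u + d 3 u at hlarge
      rcases hdec.edge ha with h | ⟨h, h' | h' | h'⟩
      · exact h
      all_goals exfalso; linarith)
    simp only [Finset.sum_pair (show (2 : Fin 4) ≠ 3 by decide)] at this
    change d 2 s + d 3 s ≤ _ at this
    linarith
  · have hsum : ∀ f : Fin 4 → ℝ, ∑ i ∈ ({0, 1, 2} : Finset (Fin 4)), f i = f 0 + f 1 + f 2 :=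
      fun f => by simp [add_assoc]
    -- If m₄ has load at least 4/3, the edge bound gives d₃ < 4ε, while empty m₁ and m₂ have no
    -- positive excess; hence a slack between 4 and 5.
    have := σ.sum_load_sub_le_of_barrier τ {0, 1, 2} isClique_triangle (c := 4.5 * ε)
      (by positivity) hs (by
      filter_upwards [hσ.decision, bounds] with u hu hb hu0 hus hlarge
      obtain ⟨hdec, ha⟩ := hu hu0
      obtain ⟨h1, -, h3, h4⟩ := hlt u hu0 hus
      have hb := hb hu0
      have hb0 := hb 0
      have hb1 := hb 1
      have hb2 := hb 2
      have hb3 := hb 3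
      rw [hsum] at hlarge ⊢
      change _ < d 0 u + d 1 u + d 2 u at hlarge
      rcases hdec.triangle ha with h | ⟨h, h', h'' | h''⟩
      · exact h
      all_goals exfalso; linarith)
    rw [hsum] at this
    change d 0 s + d 1 s + d 2 s ≤ _ at this
    linarith
  -- If m₃ is at most 1/3 and m₂ is at least m₁, then d₁ > 1/3 + cε, so d₂ > -2/3 + cε and the
  -- triangle excess exceeds 2cε, where c = 2.75. As 2c > 5 this is impossible. The factor 2 closes
  -- the cycle of slacks: 5/2 < 3 < 4 < 5.
  · have := σ.sum_load_sub_le_of_barrier τ {0, 2} (isClique_of_subset_triangle (by decide))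
      (c := 2 / 3 + 2.75 * ε) (by positivity) hs (by
      filter_upwards [hσ.decision, bounds] with u hu hb hu0 hus hlarge
      obtain ⟨hdec, ha⟩ := hu hu0
      obtain ⟨h1, h2, -, h4⟩ := hlt u hu0 hus
      have hb := hb hu0
      have hb0 := hb 0
      have hb1 := hb 1
      have hb2 := hb 2
      have hb3 := hb 3
      simp only [Finset.sum_pair (show (0 : Fin 4) ≠ 2 by decide)] at hlarge ⊢
      change _ < d 0 u + d 2 u at hlarge
      rcases hdec.triangle_left ha with h | ⟨h, h' | h' | h'⟩
      · exact h
      all_goals exfalso; linarith)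
    simp only [Finset.sum_pair (show (0 : Fin 4) ≠ 2 by decide)] at this
    change d 0 s + d 2 s ≤ _ at this
    linarith
  · have := σ.sum_load_sub_le_of_barrier τ {1, 2} (isClique_of_subset_triangle (by decide))
      (c := 2 / 3 + 2.75 * ε) (by positivity) hs (by
      filter_upwards [hσ.decision, bounds] with u hu hb hu0 hus hlarge
      obtain ⟨hdec, ha⟩ := hu hu0
      obtain ⟨h1, h2, h3, -⟩ := hlt u hu0 hus
      have hb := hb hu0
      have hb0 := hb 0
      have hb1 := hb 1
      have hb2 := hb 2
      have hb3 := hb 3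
      simp only [Finset.sum_pair (show (1 : Fin 4) ≠ 2 by decide)] at hlarge ⊢
      change _ < d 1 u + d 2 u at hlarge
      rcases hdec.triangle_right ha with h | ⟨h, h' | h' | h'⟩
      · exact h
      all_goals exfalso; linarith)
    simp only [Finset.sum_pair (show (1 : Fin 4) ≠ 2 by decide)] at this
    change d 1 s + d 2 s ≤ _ at this
    linarith

/-- The invariants of PrioGreedy relative to a schedule `τ` of buffer size `1`. -/
theorem FollowsPrioGreedy.excess_le (hσ : FollowsPrioGreedy σ)
    (hτ : ∀ t, 0 ≤ t → ∀ i, τ.load t i ≤ 1) {t : ℝ} (ht : 0 ≤ t) :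
    (σ.load t 2 - τ.load t 2) + (σ.load t 3 - τ.load t 3) ≤ 1 / 3 ∧
    (σ.load t 0 - τ.load t 0) + (σ.load t 1 - τ.load t 1) + (σ.load t 2 - τ.load t 2) ≤ 0 ∧
    (σ.load t 0 - τ.load t 0) + (σ.load t 2 - τ.load t 2) ≤ 2 / 3 ∧
    (σ.load t 1 - τ.load t 1) + (σ.load t 2 - τ.load t 2) ≤ 2 / 3 := by
  -- The largest slack is 5ε, so ε ≤ δ/5 keeps every bound within δ.
  have key : ∀ δ : ℝ, 0 < δ → 0 < min (δ / 5) (1 / 200) ∧ min (δ / 5) (1 / 200) < 1 / 100 ∧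
      min (δ / 5) (1 / 200) ≤ δ / 5 := fun δ hδ =>
    ⟨by positivity, (min_le_right _ _).trans_lt (by norm_num), min_le_left _ _⟩
  refine ⟨?_, ?_, ?_, ?_⟩ <;> refine le_of_forall_pos_le_add fun δ hδ => ?_ <;>
    obtain ⟨h0, h1, h2⟩ := key δ hδ <;>
    obtain ⟨e1, e2, e3, e4⟩ := hσ.excess_lt hτ h0 h1 ht <;> linarith

/-- Once m₃ has load at least 1/3, d₃ ≥ -2/3 and the triangle bound suffices; otherwise the pair
runs at full speed or its own load is at most 2/3. No circularity is left, hence no slack. -/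
theorem FollowsPrioGreedy.excess_pair_le (hσ : FollowsPrioGreedy σ)
    (hτ : ∀ t, 0 ≤ t → ∀ i, τ.load t i ≤ 1) {t : ℝ} (ht : 0 ≤ t) :
    (σ.load t 0 - τ.load t 0) + (σ.load t 1 - τ.load t 1) ≤ 2 / 3 := by
  have := σ.sum_load_sub_le_of_barrier τ {0, 1} (isClique_of_subset_triangle (by decide))
    (c := 2 / 3) (by norm_num) ht (by
    filter_upwards [hσ.decision] with u hu hu0 _ hlarge
    obtain ⟨hdec, ha⟩ := hu hu0
    obtain ⟨-, h2, -, -⟩ := hσ.excess_le hτ hu0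
    simp only [Finset.sum_pair (show (0 : Fin 4) ≠ 1 by decide)] at hlarge ⊢
    rcases hdec.pair ha with h | h | h
    · exact h
    · linarith [hτ u hu0 2]
    · linarith [τ.load_nonneg 0 u hu0, τ.load_nonneg 1 u hu0])
  simpa only [Finset.sum_pair (show (0 : Fin 4) ≠ 1 by decide)] using this

/-- A load above 4/3 means excess above 1/3. The pair bounds then exclude a tie between m₁ and m₂,
and for m₃ they and the edge bound exclude case (A). -/
theorem FollowsPrioGreedy.load_le (hσ : FollowsPrioGreedy σ)
    (hτ : ∀ t, 0 ≤ t → ∀ i, τ.load t i ≤ 1) {t : ℝ} (ht : 0 ≤ t) (i : Fin 4) :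
    σ.load t i ≤ 4 / 3 := by
  refine σ.load_le_of_barrier i (by norm_num) ht ?_
  filter_upwards [hσ.decision] with u hu hu0 hlarge
  obtain ⟨hdec, ha⟩ := hu hu0
  obtain ⟨e1, -, e3, e4⟩ := hσ.excess_le hτ hu0
  have e5 := hσ.excess_pair_le hτ hu0
  have hτ0 := hτ u hu0 0
  have hτ1 := hτ u hu0 1
  have hτ2 := hτ u hu0 2
  have hτ3 := hτ u hu0 3
  fin_cases i <;> simp only [Fin.zero_eta, Fin.mk_one, Fin.reduceFinMk] at hlarge ⊢
  · exact hdec.run_first ha hlarge (by linarith)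
  · exact hdec.run_second ha hlarge (by linarith)
  · rcases hdec.above_threshold (by linarith) with h | h | h | h
    · exact h
    all_goals exfalso; linarith
  · exact hdec.run_fourth hlarge

theorem ofReal_four_thirds : ENNReal.ofReal (4 / 3) = 4 / 3 := by
  rw [ENNReal.ofReal_div_of_pos (by norm_num)]
  norm_num

theorem prioGreedyIsCompetitive_four_thirds : PrioGreedyIsCompetitive (4 / 3) := by
  rintro I ⟨⟨τ, hτ⟩, -⟩ σ hσ
  refine σ.buffer_le fun t ht i => ?_
  rw [← ofReal_four_thirds]
  refine ENNReal.ofReal_le_ofReal (hσ.load_le (τ := τ) (fun t ht i => ?_) ht i)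
  exact τ.load_le_of_buffer_le zero_le_one (by simpa using hτ.le) ht i

end UpperBound

/-! ### The lower bound -/

/-- The indicator function of the time window `(a, b]`. -/
noncomputable def window (a b : ℝ) : ℝ → ℝ := (Set.Ioc a b).indicator fun _ => 1

theorem measurable_window (a b : ℝ) : Measurable (window a b) :=
  measurable_const.indicator measurableSet_Ioc

theorem intervalIntegrable_window (a b s t : ℝ) : IntervalIntegrable (window a b) volume s t := by
  refine (intervalIntegrable_const (c := (1 : ℝ))).mono_fun
    (measurable_window a b).aestronglyMeasurable (Filter.Eventually.of_forall fun u => ?_)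
  by_cases hu : u ∈ Set.Ioc a b <;> simp [window, hu]

theorem integral_window {a b t : ℝ} (ha : 0 ≤ a) (hab : a ≤ b) (ht : 0 ≤ t) :
    ∫ u in (0 : ℝ)..t, window a b u = min t b - min t a := by
  have hinter : Set.Ioc 0 t ∩ Set.Ioc a b = Set.Ioc a (min t b) := by
    rw [Set.Ioc_inter_Ioc, max_eq_right ha]
  rw [intervalIntegral.integral_of_le ht, window, setIntegral_indicator measurableSet_Ioc, hinter]
  rcases le_total t a with h | h
  · rw [Set.Ioc_eq_empty (by simp [h])]
    simp [h, h.trans hab]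
  · simp [h, hab]

/-- The hard inputs: first `m₁, m₂, m₃` receive load in `(0, 1]`, then `p` and `q` receive load in
`(2, 4]`. -/
def hardInput (p q : Fin 4) : FlowInput (Fin 4) where
  receives i := {t | i ≠ 3 ∧ (t ∈ Set.Ioc 0 1 ∨ ((i = p ∨ i = q) ∧ t ∈ Set.Ioc 2 4))}
  measurable_receives i := by
    have h1 : MeasurableSet (Set.Ioc (0 : ℝ) 1) := measurableSet_Ioc
    have h2 : MeasurableSet (Set.Ioc (2 : ℝ) 4) := measurableSet_Ioc
    exact (MeasurableSet.const _).inter (h1.union ((MeasurableSet.const _).inter h2))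
  finite_horizon := by
    refine ⟨4, fun i t ht => ?_⟩
    rcases ht.2 with h | ⟨-, h⟩ <;> exact ⟨by linarith [h.1], by linarith [h.2]⟩

theorem rate_hardInput {p q i : Fin 4} (hi : i ≠ 3) (t : ℝ) :
    (hardInput p q).rate i t = window 0 1 t + if i = p ∨ i = q then window 2 4 t else 0 := by
  have hiff : t ∈ (hardInput p q).receives i ↔
      t ∈ Set.Ioc 0 1 ∨ ((i = p ∨ i = q) ∧ t ∈ Set.Ioc 2 4) :=
    ⟨fun h => h.2, fun h => ⟨hi, h⟩⟩
  by_cases h1 : t ∈ Set.Ioc (0 : ℝ) 1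
  · have h2 : t ∉ Set.Ioc (2 : ℝ) 4 := fun h => by linarith [h1.2, h.1]
    rw [FlowInput.rate, Set.indicator_of_mem (hiff.2 (Or.inl h1)), window, window,
      Set.indicator_of_mem h1, Set.indicator_of_notMem h2, ite_self, add_zero]
  rw [window, Set.indicator_of_notMem h1, zero_add]
  by_cases h2 : (i = p ∨ i = q) ∧ t ∈ Set.Ioc 2 4
  · rw [FlowInput.rate, Set.indicator_of_mem (hiff.2 (Or.inr h2)), if_pos h2.1, window,
      Set.indicator_of_mem h2.2]
  · rw [FlowInput.rate, Set.indicator_of_notMem (fun h => (hiff.1 h).elim h1 h2)]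
    split_ifs with hpq
    · rw [window, Set.indicator_of_notMem fun h => h2 ⟨hpq, h⟩]
    · rfl

theorem rate_hardInput_three (p q : Fin 4) (t : ℝ) : (hardInput p q).rate 3 t = 0 := by
  have : t ∉ (hardInput p q).receives 3 := fun h => h.1 rfl
  simp [FlowInput.rate, this]

theorem integral_rate_hardInput {p q i : Fin 4} (hi : i ≠ 3) {t : ℝ} (ht : 0 ≤ t) :
    ∫ u in (0 : ℝ)..t, (hardInput p q).rate i u =
      min t 1 + if i = p ∨ i = q then min t 4 - min t 2 else 0 := by
  simp only [rate_hardInput hi]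
  split_ifs
  · rw [intervalIntegral.integral_add (intervalIntegrable_window ..)
      (intervalIntegrable_window ..), integral_window le_rfl zero_le_one ht,
      integral_window (by norm_num) (by norm_num) ht, min_eq_right ht, sub_zero]
  · simp only [add_zero]
    rw [integral_window le_rfl zero_le_one ht, min_eq_right ht, sub_zero]

/-- The speeds of the optimal schedule on a hard input: run `p` in `(0, 1]`, run `q` in `(1, 2]`,
and share the time equally between `p` and `q` in `(2, 4]`. -/
noncomputable def hardSpeed (p q : Fin 4) (t : ℝ) (i : Fin 4) : ℝ :=
  (if i = p then window 0 1 t + window 2 4 t / 2 else 0) +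
    if i = q then window 1 2 t + window 2 4 t / 2 else 0

theorem window_nonneg (a b t : ℝ) : 0 ≤ window a b t :=
  Set.indicator_nonneg (fun _ _ => zero_le_one) t

theorem hardSpeed_nonneg (p q : Fin 4) (t : ℝ) (i : Fin 4) : 0 ≤ hardSpeed p q t i := by
  have h1 := window_nonneg 0 1 t
  have h2 := window_nonneg 1 2 t
  have h3 := window_nonneg 2 4 t
  unfold hardSpeed
  split_ifs <;> positivity

theorem sum_hardSpeed_le (p q : Fin 4) (t : ℝ) (K : Finset (Fin 4)) :
    ∑ i ∈ K, hardSpeed p q t i ≤ 1 := by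
  calc ∑ i ∈ K, hardSpeed p q t i ≤ ∑ i, hardSpeed p q t i :=
        Finset.sum_le_sum_of_subset_of_nonneg (Finset.subset_univ K)
          fun i _ _ => hardSpeed_nonneg p q t i
    _ = window 0 1 t + window 1 2 t + window 2 4 t := by
        simp only [hardSpeed, Finset.sum_add_distrib, Finset.sum_ite_eq', Finset.mem_univ, if_true]
        ring
    _ ≤ 1 := by
        simp only [window, Set.indicator_apply, Set.mem_Ioc]
        split_ifs <;> norm_num <;> grind

/-- The loads of the optimal schedule on a hard input. -/
noncomputable def hardLoad (p q : Fin 4) (t : ℝ) (i : Fin 4) : ℝ :=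
  if i = 3 then 0 else if i = p then (min t 4 - min t 2) / 2
  else if i = q then min t 1 - (min t 2 - min t 1) + (min t 4 - min t 2) / 2
  else min t 1

theorem hardLoad_mem_Icc (p q : Fin 4) {t : ℝ} (ht : 0 ≤ t) (i : Fin 4) :
    hardLoad p q t i ∈ Set.Icc 0 1 := by
  unfold hardLoad
  split_ifs <;> constructor <;> grind

theorem intervalIntegrable_hardSpeed (p q i : Fin 4) (s t : ℝ) :
    IntervalIntegrable (fun u => hardSpeed p q u i) volume s t := by
  have h1 : IntervalIntegrable (fun u => window 0 1 u + window 2 4 u / 2) volume s t :=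
    (intervalIntegrable_window ..).add ((intervalIntegrable_window ..).div_const 2)
  have h2 : IntervalIntegrable (fun u => window 1 2 u + window 2 4 u / 2) volume s t :=
    (intervalIntegrable_window ..).add ((intervalIntegrable_window ..).div_const 2)
  unfold hardSpeed
  refine IntervalIntegrable.add ?_ ?_ <;> split_ifs <;> first | assumption | simp

theorem integral_hardSpeed {p q i : Fin 4} (hpq : p ≠ q) {t : ℝ} (ht : 0 ≤ t) :
    ∫ u in (0 : ℝ)..t, hardSpeed p q u i =
      if i = p then min t 1 + (min t 4 - min t 2) / 2
      else if i = q then min t 2 - min t 1 + (min t 4 - min t 2) / 2 else 0 := by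
  have key : ∀ a b : ℝ, 0 ≤ a → a ≤ b → ∫ u in (0 : ℝ)..t, (window a b u + window 2 4 u / 2) =
      min t b - min t a + (min t 4 - min t 2) / 2 := fun a b ha hab => by
    rw [intervalIntegral.integral_add (intervalIntegrable_window ..)
      ((intervalIntegrable_window ..).div_const 2), intervalIntegral.integral_div,
      integral_window ha hab ht, integral_window (by norm_num) (by norm_num) ht]
  unfold hardSpeed
  by_cases hp : i = p
  · have hq : i ≠ q := hp ▸ hpq
    simp only [hp, hpq, if_true, if_false, add_zero]
    rw [key 0 1 le_rfl zero_le_one, min_eq_right ht, sub_zero]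
  by_cases hq : i = q
  · simp only [hq, hpq.symm, if_true, if_false, zero_add]
    rw [key 1 2 zero_le_one one_le_two]
  · simp [hp, hq]

/-- The optimal schedule on a hard input. -/
noncomputable def hardSchedule (G : SimpleGraph (Fin 4)) {p q : Fin 4} (hpq : p ≠ q) (hp : p ≠ 3)
    (hq : q ≠ 3) : FlowSchedule G (hardInput p q) where
  speed := hardSpeed p q
  load := hardLoad p q
  measurable_speed i := by
    have h1 := measurable_window 0 1
    have h2 := measurable_window 1 2
    have h3 := measurable_window 2 4
    unfold hardSpeed
    refine Measurable.add ?_ ?_ <;> split_ifs <;> fun_prop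
  speed_nonneg i := Filter.Eventually.of_forall fun t _ => hardSpeed_nonneg p q t i
  speed_clique K _ := Filter.Eventually.of_forall fun t _ => sum_hardSpeed_le p q t K
  load_eq i t ht := by
    rw [intervalIntegral.integral_sub ((hardInput p q).intervalIntegrable_rate i 0 t)
      (intervalIntegrable_hardSpeed p q i 0 t), integral_hardSpeed hpq ht]
    by_cases h3 : i = 3
    · subst h3
      simp [hardLoad, rate_hardInput_three, hp.symm, hq.symm]
    · rw [integral_rate_hardInput h3 ht]
      by_cases hip : i = p
      · simp only [hardLoad, hip, hp, true_or, if_true, if_false]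
        ring
      by_cases hiq : i = q
      · simp only [hardLoad, hiq, hq, hpq.symm, or_true, if_true, if_false]
        ring
      -- The third triangle machine is never run and keeps its one unit forever, which buffer 1
      -- allows.
      · simp [hardLoad, h3, hip, hiq]
  load_nonneg i t ht := (hardLoad_mem_Icc p q ht i).1

/-! ### Arbitrary schedules and online algorithms on the hard inputs -/

section HardInput

variable {p q : Fin 4}

/-- In `(2, 4]`, the total load of `p` and `q` grows by at least `2`. -/
theorem load_growth_hardInput (hpq : p ≠ q) (hp : p ≠ 3) (hq : q ≠ 3)
    (σ : FlowSchedule triangleWithPendant (hardInput p q)) :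
    σ.load 2 p + σ.load 2 q + 2 ≤ σ.load 4 p + σ.load 4 q := by
  have hK : ({p, q} : Finset (Fin 4)) ⊆ {0, 1, 2} := by
    clear σ
    decide +revert
  have h := σ.sum_arrivals_sub_le {p, q} (isClique_of_subset_triangle hK)
    (show (0 : ℝ) ≤ 2 by norm_num) (show (2 : ℝ) ≤ 4 by norm_num)
  have hint : ∀ i : Fin 4, i ≠ 3 → (i = p ∨ i = q) →
      ∫ u in (2 : ℝ)..4, (hardInput p q).rate i u = 2 := fun i hi hipq => by
    have := intervalIntegral.integral_interval_sub_left
      ((hardInput p q).intervalIntegrable_rate i 0 4)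
      ((hardInput p q).intervalIntegrable_rate i 0 2)
    rw [← this, integral_rate_hardInput hi (by norm_num), integral_rate_hardInput hi (by norm_num)]
    simp only [hipq, if_true]
    norm_num
  simp only [Finset.sum_pair hpq] at h
  rw [hint p hp (Or.inl rfl), hint q hq (Or.inr rfl)] at h
  linarith

/-- At time `2` the triangle still has total load at least `1`. -/
theorem one_le_load_two_hardInput (σ : FlowSchedule triangleWithPendant (hardInput p q)) :
    1 ≤ σ.load 2 0 + σ.load 2 1 + σ.load 2 2 := by
  have h := σ.sum_arrivals_sub_le {0, 1, 2} isClique_triangle le_rfl (show (0 : ℝ) ≤ 2 by norm_num)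
  have hint : ∀ i : Fin 4, i ≠ 3 → ∫ u in (0 : ℝ)..2, (hardInput p q).rate i u = 1 :=
    fun i hi => by
      rw [integral_rate_hardInput hi (by norm_num)]
      norm_num
  have hsum : ∀ f : Fin 4 → ℝ, ∑ i ∈ ({0, 1, 2} : Finset (Fin 4)), f i = f 0 + f 1 + f 2 :=
    fun f => by simp [add_assoc]
  rw [hsum, hsum, hint 0 (by decide), hint 1 (by decide), hint 2 (by decide), σ.load_zero,
    σ.load_zero, σ.load_zero] at h
  linarith

/-- The larger of the two loads at time 4 is at least their mean. -/
theorem ofReal_le_buffer_hardInput (hpq : p ≠ q) (hp : p ≠ 3) (hq : q ≠ 3)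
    (σ : FlowSchedule triangleWithPendant (hardInput p q)) :
    ENNReal.ofReal ((σ.load 2 p + σ.load 2 q + 2) / 2) ≤ σ.buffer := by
  have h := load_growth_hardInput hpq hp hq σ
  rcases le_total (σ.load 4 p) (σ.load 4 q) with hle | hle
  · exact (ENNReal.ofReal_le_ofReal (by linarith)).trans
      (σ.ofReal_load_le_buffer (show (0 : ℝ) ≤ 4 by norm_num) q)
  · exact (ENNReal.ofReal_le_ofReal (by linarith)).trans
      (σ.ofReal_load_le_buffer (show (0 : ℝ) ≤ 4 by norm_num) p)

theorem isOpt_hardInput (hpq : p ≠ q) (hp : p ≠ 3) (hq : q ≠ 3) :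
    IsOpt triangleWithPendant (hardInput p q) 1 := by
  have hlow : ∀ σ : FlowSchedule triangleWithPendant (hardInput p q), 1 ≤ σ.buffer := fun σ => by
    refine le_trans ?_ (ofReal_le_buffer_hardInput hpq hp hq σ)
    rw [ENNReal.one_le_ofReal]
    linarith [σ.load_nonneg p 2 (by norm_num), σ.load_nonneg q 2 (by norm_num)]
  refine ⟨⟨hardSchedule _ hpq hp hq, le_antisymm ?_ (hlow _)⟩, ?_⟩
  · refine FlowSchedule.buffer_le _ fun t ht i => ?_
    rw [ENNReal.ofReal_le_one]
    exact (hardLoad_mem_Icc p q ht i).2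
  · rintro _ ⟨σ, rfl⟩
    exact hlow σ

/-- An online algorithm cannot distinguish the hard inputs before time `2`. -/
theorem OnlineAlgorithm.load_two_hardInput (A : OnlineAlgorithm triangleWithPendant)
    (p q p' q' : Fin 4) (i : Fin 4) :
    (A.run (hardInput p q)).load 2 i = (A.run (hardInput p' q')).load 2 i := by
  refine A.online _ _ 2 (fun j => ?_) 2 ⟨by norm_num, le_rfl⟩ i
  ext t
  simp only [hardInput, Set.mem_inter_iff, Set.mem_ofPred_eq, Set.mem_Icc, Set.mem_Ioc]
  constructor <;> rintro ⟨⟨hj, h | ⟨-, h⟩⟩, ht⟩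
  · exact ⟨⟨hj, Or.inl h⟩, ht⟩
  · linarith
  · exact ⟨⟨hj, Or.inl h⟩, ht⟩
  · linarith

end HardInput

theorem RandomizedOnlineAlgorithm.IsCompetitive.four_thirds_le {Ω : Type*} [MeasurableSpace Ω]
    {P : Measure Ω} [IsProbabilityMeasure P]
    {A : RandomizedOnlineAlgorithm triangleWithPendant Ω} {R : ℝ≥0∞} (hA : A.IsCompetitive P R) :
    4 / 3 ≤ R := by
  let x : Fin 4 → Ω → ℝ := fun i ω => ((A.alg ω).run (hardInput 0 1)).load 2 i
  have hx : ∀ i, Measurable (x i) := fun i => A.measurable_load _ 2 (by norm_num) i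
  have hx0 : ∀ i ω, 0 ≤ x i ω := fun i ω => FlowSchedule.load_nonneg _ i 2 (by norm_num)
  let f : Fin 4 → Fin 4 → Ω → ℝ≥0∞ := fun p q ω => ENNReal.ofReal ((x p ω + x q ω + 2) / 2)
  have hf : ∀ p q, Measurable (f p q) := fun p q =>
    (((hx p).add (hx q)).add_const 2).div_const 2 |>.ennreal_ofReal
  have hR : ∀ p q : Fin 4, p ≠ q → p ≠ 3 → q ≠ 3 → ∫⁻ ω, f p q ω ∂P ≤ R := by
    intro p q hpq hp hq
    refine le_trans (lintegral_mono fun ω => ?_) (hA _ (isOpt_hardInput hpq hp hq))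
    have := ofReal_le_buffer_hardInput hpq hp hq ((A.alg ω).run (hardInput p q))
    -- The loads at time 2 do not depend on the pair, so `hardInput 0 1` serves as the common
    -- reference.
    rwa [(A.alg ω).load_two_hardInput p q 0 1 p, (A.alg ω).load_two_hardInput p q 0 1 q] at this
  -- Each machine lies in two of the three pairs, so pointwise the sum is x₁ + x₂ + x₃ + 3, which is
  -- at least 4.
  have hsum : (4 : ℝ≥0∞) ≤ ∫⁻ ω, (f 0 1 ω + f 0 2 ω + f 1 2 ω) ∂P := by
    calc (4 : ℝ≥0∞) = ∫⁻ _, 4 ∂P := by simp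
      _ ≤ _ := lintegral_mono fun ω => ?_
    have hpos : ∀ p q, 0 ≤ (x p ω + x q ω + 2) / 2 := fun p q => by
      linarith [hx0 p ω, hx0 q ω]
    have h1 : 1 ≤ x 0 ω + x 1 ω + x 2 ω := one_le_load_two_hardInput _
    simp only [f]
    rw [← ENNReal.ofReal_add (hpos _ _) (hpos _ _),
      ← ENNReal.ofReal_add (add_nonneg (hpos _ _) (hpos _ _)) (hpos _ _),
      ← ENNReal.ofReal_ofNat]
    exact ENNReal.ofReal_le_ofReal (by linarith)
  rw [lintegral_add_right _ (hf 1 2), lintegral_add_left (hf 0 1)] at hsum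
  refine ENNReal.div_le_of_le_mul (hsum.trans ?_)
  calc _ ≤ R + R + R := by
        gcongr
        · exact hR 0 1 (by decide) (by decide) (by decide)
        · exact hR 0 2 (by decide) (by decide) (by decide)
        · exact hR 1 2 (by decide) (by decide) (by decide)
    _ = R * 3 := by ring

theorem mainTheorem5 :
    PrioGreedyIsCompetitive (4 / 3) ∧
      ∀ (Ω : Type*) [MeasurableSpace Ω] (P : Measure Ω) [IsProbabilityMeasure P]
        (A : RandomizedOnlineAlgorithm triangleWithPendant Ω) (R : ℝ≥0∞),
        A.IsCompetitive P R → 4 / 3 ≤ R :=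
  ⟨prioGreedyIsCompetitive_four_thirds, fun _ _ _ _ _ _ hA => hA.four_thirds_le⟩
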